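/- Let $A$ be a unital commutative real algebra. For a unital commutative real algebra $B$ let $X(B)$ be the set of all unital algebra homomorphisms $\alpha:B\to\mathbb{R}$, with the weakest topology making all maps $\hat b:\alpha\mapsto\alpha(b)$, $b\in B$, continuous, and with its Borel $\sigma$-algebra $\mathcal{B}(X(B))$. For unital subalgebras $S\subseteq T\subseteq A$ let $\pi_{S,T}:X(T)\to X(S)$ and $\pi_S:X(A)\to X(S)$ be the restriction maps. Let $I$ (resp. $\Lambda$) be the set of all finitely (resp. countably) generated unital subalgebras of $A$, ordered by inclusion, and let $\Sigma_I$ (the cylinder $\sigma$-algebra) be the smallest $\sigma$-algebra on $X(A)$ making all $\pi_S:X(A)\to (X(S),\mathcal{B}(X(S)))$, $S\in I$, measurable. A Radon measure is a locally finite Borel measure that is inner regular with respect to compact sets. Given a linear functional $L$ on $B$, a $\sigma$-algebra $\Sigma$ on $X(B)$ and $K\in\Sigma$, a measure $\mu$ on $\Sigma$ is called $K$-representing for $L$ if $\mu(X(B)\setminus K)=0$ and, for all $b\in B$, $\hat b$ is $\mu$-integrable with $L(b)=\int\hat b\,d\mu$. A family of Borel measures $\mu_S$ on $X(S)$, indexed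 by $I$ or by $\Lambda$, is exact if the pushforward of $\mu_T$ under $\pi_{S,T}$ equals $\mu_S$ whenever $S\subseteq T$; a family $(\mu_T)_{T\in\Lambda}$ is thick if, for all $T\in\Lambda$, $\mu_T(M)=0$ for every Borel set $M\subseteq X(T)$ disjoint from $\pi_T(X(A))$. For every exact family $(\mu_S)_{S\in I}$ of Radon probability measures and every $T\in\Lambda$ there is a unique Radon probability measure $\mu_T$ on $X(T)$ whose pushforward under $\pi_{S,T}$ is $\mu_S$ for all $S\in I$ with $S\subseteq T$, and the family $(\mu_T)_{T\in\Lambda}$ is exact; call it the family induced by $(\mu_S)_{S\in I}$. Theorem. Let $L:A\to\mathbb{R}$ be linear with $L(1)=1$. For each $S\in I$ let $K^{(S)}\subseteq X(S)$ be closed, such that $\pi_{S,T}(K^{(T)})\subseteq K^{(S)}$ for all $S\subseteq T$ in $I$. (i) There exists an $X(A)$-representing measure $\mu$ for $L$ on $\Sigma_I$ with $\mu(X(A)\setminus\pi_S^{-1}(K^{(S)}))=0$ for every $S\in I$ if and only if for every $S\in I$ there exists a $K^{(S)}$-representing Radon measure $\mu_S$ for $L|_S$ such that $(\mu_S)_{S\in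 I}$ is exact and the induced family $(\mu_T)_{T\in\Lambda}$ is thick. (ii) There exists a $\bigl(\bigcap_{S\in I}\pi_S^{-1}(K^{(S)})\bigr)$-representing Radon measure $\nu$ for $L$ on $\mathcal{B}(X(A))$ if and only if for every $S\in I$ there exists a $K^{(S)}$-representing Radon measure $\mu_S$ for $L|_S$ such that Prokhorov's condition holds: for every $\varepsilon>0$ there is a compact $C_\varepsilon\subseteq X(A)$ with $\mu_S(\pi_S(C_\varepsilon))\ge 1-\varepsilon$ for all $S\in I$. -/

import Mathlib

open MeasureTheory

namespace CharMoment

/-- The character space `X(B)` of a unital commutative real algebra `B`: the set of all unital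
algebra homomorphisms `B → ℝ`. -/
abbrev CharSpace (B : Type*) [CommRing B] [Algebra ℝ B] : Type _ := B →ₐ[ℝ] ℝ

section Basic

variable {B : Type*} [CommRing B] [Algebra ℝ B]

/-- The topology on `X(B)` induced by the embedding `X(B) → ℝ^B`, `α ↦ (α a)_a`, that is, the
weakest topology making all evaluations `α ↦ α a` continuous. -/
instance : TopologicalSpace (CharSpace B) :=
  TopologicalSpace.induced (fun (α : CharSpace B) (a : B) => α a) inferInstance

/-- The default `σ`-algebra on `X(B)` is the Borel `σ`-algebra. -/
instance : MeasurableSpace (CharSpace B) := borel (CharSpace B)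

instance : BorelSpace (CharSpace B) := ⟨rfl⟩

theorem continuous_eval (a : B) : Continuous (fun α : CharSpace B => α a) :=
  (continuous_apply a).comp continuous_induced_dom

instance : T2Space (CharSpace B) :=
  T2Space.of_injective_continuous (f := fun (α : CharSpace B) (a : B) => α a)
    (fun _ _ h => AlgHom.ext fun a => congrFun h a) continuous_induced_dom

/-- A Radon measure on a topological space with its Borel `σ`-algebra: locally finite, and inner
regular on Borel sets with respect to compact sets. -/
structure IsRadon {X : Type*} [TopologicalSpace X] [MeasurableSpace X] (μ : Measure X) : Prop where
  locallyFinite : IsLocallyFiniteMeasure μ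
  innerRegular : μ.InnerRegular

/-- `μ`, a measure on some `σ`-algebra `m` on `X(B)`, is a `K`-representing measure for `L`:
it is supported in `K`, and `L a = ∫ α(a) dμ(α)` for all `a` (all these integrals exist). -/
structure IsRepresenting (L : B →ₗ[ℝ] ℝ) (K : Set (CharSpace B))
    {m : MeasurableSpace (CharSpace B)} (μ : Measure (CharSpace B)) : Prop where
  supported : μ Kᶜ = 0
  integrable : ∀ a : B, Integrable (fun α : CharSpace B => α a) μ
  integral_eq : ∀ a : B, L a = ∫ α : CharSpace B, α a ∂μ

end Basic

section Restriction

variable {A : Type*} [CommRing A] [Algebra ℝ A]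

/-- The restriction map `π_S : X(A) → X(S)`. -/
def res (S : Subalgebra ℝ A) (α : CharSpace A) : CharSpace S := α.comp S.val

/-- The restriction map `π_{S,T} : X(T) → X(S)` for `S ⊆ T`. -/
def resLE {S T : Subalgebra ℝ A} (h : S ≤ T) (α : CharSpace T) : CharSpace S :=
  α.comp (Subalgebra.inclusion h)

theorem continuous_res (S : Subalgebra ℝ A) : Continuous (res S) :=
  continuous_induced_rng.2 (continuous_pi fun a => continuous_eval (a : A))

theorem continuous_resLE {S T : Subalgebra ℝ A} (h : S ≤ T) : Continuous (resLE h) :=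
  continuous_induced_rng.2 (continuous_pi fun a => continuous_eval (Subalgebra.inclusion h a))

/-- The restriction of a linear functional on `A` to a subalgebra. -/
def restrictFunctional (L : A →ₗ[ℝ] ℝ) (S : Subalgebra ℝ A) : S →ₗ[ℝ] ℝ :=
  L ∘ₗ S.val.toLinearMap

end Restriction

section Systems

variable (A : Type*) [CommRing A] [Algebra ℝ A]

/-- The index set `I` of all finitely generated subalgebras of `A`. -/
abbrev FGSub : Type _ := {S : Subalgebra ℝ A // S.FG}

/-- The index set `Λ` of all countably generated subalgebras of `A`. -/
abbrev CGSub : Type _ :=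
  {T : Subalgebra ℝ A // ∃ G : Set A, G.Countable ∧ Algebra.adjoin ℝ G = T}

/-- The cylinder `σ`-algebra `Σ_I` on `X(A)`: the smallest `σ`-algebra making every
`π_S : X(A) → X(S)`, with `S` finitely generated, measurable. -/
@[reducible] def cylinderSigma : MeasurableSpace (CharSpace A) :=
  ⨆ S : FGSub A, MeasurableSpace.comap (res S.1) (borel (CharSpace S.1))

variable {A}

/-- Exactness of a family of Borel measures on the spaces `X(S)`, `S` running through the
subalgebras with property `P`: the pushforward of `μ_T` under `π_{S,T}` is `μ_S`. -/
def IsExact {P : Subalgebra ℝ A → Prop}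
    (μ : ∀ S : {S : Subalgebra ℝ A // P S}, Measure (CharSpace S.1)) : Prop :=
  ∀ (S T : {S : Subalgebra ℝ A // P S}) (h : S.1 ≤ T.1), (μ T).map (resLE h) = μ S

/-- Thickness: for each index `T`, every Borel subset of `X(T)` disjoint from `π_T(X(A))` is
`μ_T`-null. -/
def IsThick {P : Subalgebra ℝ A → Prop}
    (μ : ∀ S : {S : Subalgebra ℝ A // P S}, Measure (CharSpace S.1)) : Prop :=
  ∀ (T : {S : Subalgebra ℝ A // P S}) (M : Set (CharSpace T.1)), MeasurableSet M →
    Disjoint (Set.range (res T.1)) M → μ T M = 0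

/-- `ν = (μ_T)_{T ∈ Λ}` corresponds to `μ = (μ_S)_{S ∈ I}`: each `μ_T` is a Radon
probability measure on `X(T)` whose pushforward under `π_{S,T}` is `μ_S` for all
finitely generated `S ⊆ T`. -/
def IsInduced (μ : ∀ S : FGSub A, Measure (CharSpace S.1))
    (ν : ∀ T : CGSub A, Measure (CharSpace T.1)) : Prop :=
  ∀ T : CGSub A, IsRadon (ν T) ∧ IsProbabilityMeasure (ν T) ∧
    ∀ (S : FGSub A) (h : S.1 ≤ T.1), (ν T).map (resLE h) = μ S

/-- Prokhorov's condition: for every `ε > 0` there is a compact `C ⊆ X(A)` with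
`μ_S(π_S(C)) ≥ 1 - ε` for all finitely generated `S`. -/
def Prokhorov (μ : ∀ S : FGSub A, Measure (CharSpace S.1)) : Prop :=
  ∀ ε : ℝ, 0 < ε → ∃ C : Set (CharSpace A), IsCompact C ∧
    ∀ S : FGSub A, ENNReal.ofReal (1 - ε) ≤ μ S (res S.1 '' C)

end Systems

end CharMoment

/-! For (ii), let U be an ultrafilter on I finer than `atTop`. The limits along U of μ_S(π_S(C))
form a content on the compact sets C of X(A), additive because disjoint compact sets have disjoint
images at all large stages. Prokhorov's condition makes the resulting measure ν an inner regular
probability measure. Since the μ_S need not be exact, only half of weak convergence is at hand: if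
s_S eventually contains π_S(O), with O open, then ν(O) ≤ liminf μ_S(s_S)
(`exists_innerRegular_limit`). This half suffices. Applied to superlevel sets of â² it gives ∫ â² dν
≤ L(a²), and replacing a by a + c·1 for all real c forces ∫ â dν = L(a)
(`integral_eq_of_lintegral_sq_le`). Applied to the complements of the sets π_S⁻¹(K_S) it gives the
support.

For (i), X(T) with T countably generated is closed in ℝ^ℕ, hence Polish, so its finite Borel
measures are Radon. The induced family comes from the same limit construction along a tower of
finitely generated algebras exhausting T: exactness supplies the tightness and turns domination on
open sets into equality of the projections (`CGSub.exists_extension`). Every set of Σ_I is π_T⁻¹(M)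
for some T in Λ and M Borel, and thickness makes π_T⁻¹(M) ↦ μ_T(M) well defined and countably
additive (`IsThick.exists_measure`). Conversely, pushforwards of a measure on Σ_I are thick, as a
set missing the range of π_T has empty preimage. -/

namespace CharMoment

open Filter Topology TopologicalSpace
open scoped ENNReal NNReal

/-! ### Radon limits of uniformly tight families -/

section ProjectiveTightness

variable {X ι : Type*} {Y : ι → Type*} [TopologicalSpace X] [Preorder ι] [IsDirectedOrder ι]
  [Nonempty ι] [∀ i, TopologicalSpace (Y i)] [∀ i, T2Space (Y i)]

/-- Disjoint compact sets are separated by a sufficiently large projection. -/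
theorem eventually_disjoint_image {p : ∀ i, X → Y i} (hp : ∀ i, Continuous (p i))
    (hsep : ∀ x y, x ≠ y → ∃ i, p i x ≠ p i y)
    (hmono : ∀ i j, i ≤ j → ∀ x y, p j x = p j y → p i x = p i y)
    {C D : Set X} (hC : IsCompact C) (hD : IsCompact D) (hCD : Disjoint C D) :
    ∀ᶠ i in atTop, Disjoint (p i '' C) (p i '' D) := by
  -- The open sets of pairs separated at stage i increase with i and cover the compact set C × D, so
  -- a single stage separates all its pairs.
  obtain ⟨i, hi⟩ := (hC.prod hD).elim_directed_cover
    (fun i => {z : X × X | p i z.1 ≠ p i z.2})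
    (fun i => isOpen_ne_fun ((hp i).comp continuous_fst) ((hp i).comp continuous_snd))
    (fun z hz => by
      obtain ⟨i, hi⟩ := hsep z.1 z.2 fun h => hCD.ne_of_mem hz.1 hz.2 h
      exact Set.mem_iUnion.2 ⟨i, hi⟩)
    (directed_of_isDirected_le fun i j hij z hz h => hz (hmono i j hij _ _ h))
  filter_upwards [eventually_ge_atTop i] with j hij
  rw [Set.disjoint_left]
  rintro _ ⟨x, hx, rfl⟩ ⟨y, hy, hxy⟩
  exact hi (Set.mk_mem_prod hx hy) (hmono i j hij _ _ hxy.symm)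

variable [∀ i, MeasurableSpace (Y i)] [∀ i, BorelSpace (Y i)]

/-- The content on compact sets obtained as the limit of the measures of their projections along an
ultrafilter. -/
theorem exists_limit_content {p : ∀ i, X → Y i} (hp : ∀ i, Continuous (p i))
    (hsep : ∀ x y, x ≠ y → ∃ i, p i x ≠ p i y)
    (hmono : ∀ i j, i ≤ j → ∀ x y, p j x = p j y → p i x = p i y)
    (μ : ∀ i, Measure (Y i)) [∀ i, IsProbabilityMeasure (μ i)]
    (U : Ultrafilter ι) (hU : (U : Filter ι) ≤ atTop) :
    ∃ c : Content X, ∀ C : Compacts X,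
      Tendsto (fun i => μ i (p i '' C)) U (𝓝 (c C)) := by
  have hex : ∀ C : Compacts X, ∃ r : ℝ≥0,
      Tendsto (fun i => (μ i (p i '' C)).toNNReal) U (𝓝 r) := by
    intro C
    obtain ⟨r, -, hr⟩ := (isCompact_Icc (a := (0 : ℝ≥0)) (b := 1)).ultrafilter_le_nhds
      (U.map fun i => (μ i (p i '' C)).toNNReal) (by
        rw [le_principal_iff]
        refine mem_map.2 (Eventually.of_forall fun i => ⟨zero_le, ?_⟩)
        simpa using ENNReal.toNNReal_mono ENNReal.one_ne_top (prob_le_one (μ := μ i)))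
    exact ⟨r, hr⟩
  choose c hc using hex
  refine ⟨⟨c, ?_, ?_, ?_⟩, ?_⟩
  · intro C D hCD
    exact le_of_tendsto_of_tendsto' (hc C) (hc D) fun i =>
      ENNReal.toNNReal_mono (measure_ne_top _ _) (measure_mono (Set.image_mono hCD))
  · intro C D hCD hC hD
    refine tendsto_nhds_unique (hc _) (((hc C).add (hc D)).congr' ?_)
    filter_upwards [hU (eventually_disjoint_image hp hsep hmono C.isCompact D.isCompact hCD)]
      with i hi
    rw [← ENNReal.toNNReal_add (measure_ne_top _ _) (measure_ne_top _ _), Compacts.coe_sup,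
      Set.image_union, measure_union hi (D.isCompact.image (hp i)).measurableSet]
  · intro C D
    refine le_of_tendsto_of_tendsto' (hc _) ((hc C).add (hc D)) fun i => ?_
    rw [← ENNReal.toNNReal_add (measure_ne_top _ _) (measure_ne_top _ _), Compacts.coe_sup,
      Set.image_union]
    exact ENNReal.toNNReal_mono (by finiteness) (measure_union_le _ _)
  · intro C
    refine (ENNReal.tendsto_coe.2 (hc C)).congr fun i => ?_
    exact ENNReal.coe_toNNReal (measure_ne_top _ _)

/-- A tight probability measure which is outer regular is inner regular with respect to compact
sets. -/
theorem innerRegular_of_outerRegular_of_tight [T2Space X] [MeasurableSpace X] [BorelSpace X]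
    (ν : Measure X) [IsProbabilityMeasure ν] [ν.OuterRegular]
    (h : ∀ ε : ℝ≥0∞, ε ≠ 0 → ∃ C, IsCompact C ∧ ν Cᶜ ≤ ε) : ν.InnerRegular := by
  refine ⟨fun B hB r hr => ?_⟩
  have hpos : ν B - r ≠ 0 := (tsub_pos_of_lt hr).ne'
  -- Two errors, one from V and one from C, each cost a quarter of the gap, so together they stay
  -- strictly below it.
  have hε : (ν B - r) / 4 ≠ 0 := by simp [hpos]
  obtain ⟨C, hC, hCε⟩ := h _ hε
  obtain ⟨V, hBV, hV, hVε⟩ := hB.compl.exists_isOpen_sdiff_lt (measure_ne_top ν _) hε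
  refine ⟨Vᶜ ∩ C, fun x hx => by_contra fun hxB => hx.1 (hBV hxB), hC.inter_left hV.isClosed_compl, ?_⟩
  have hsub : B ⊆ (Vᶜ ∩ C) ∪ (V \ Bᶜ ∪ Cᶜ) := by
    intro x hx
    by_cases hxC : x ∈ C <;> by_cases hxV : x ∈ V <;> simp [hx, hxC, hxV]
  have h1 : ν B ≤ ν (Vᶜ ∩ C) + ((ν B - r) / 4 + (ν B - r) / 4) :=
    (measure_mono hsub).trans <| (measure_union_le _ _).trans <| by
      gcongr
      exact (measure_union_le _ _).trans (add_le_add hVε.2.le hCε)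
  by_contra! hle
  have hfin : r ≠ ∞ := (hr.trans_le le_top).ne
  have h2 : (ν B - r) / 4 + (ν B - r) / 4 = (ν B - r) / 2 := by
    rw [← ENNReal.add_div, ← two_mul, mul_comm, show (4 : ℝ≥0∞) = 2 * 2 by norm_num]
    exact ENNReal.mul_div_mul_right _ _ (by norm_num) (by norm_num)
  have h3 : ν B - r ≤ (ν B - r) / 2 := by
    rw [tsub_le_iff_left, ← h2]
    exact h1.trans (by gcongr)
  exact absurd h3 (not_le.2 (ENNReal.half_lt_self hpos (by finiteness)))

/-- A uniformly tight family of probability measures on the projections of `X` has a Radon limit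
measure on `X`. No compatibility of the family is required. -/
theorem exists_innerRegular_limit [T2Space X] [MeasurableSpace X] [BorelSpace X]
    {p : ∀ i, X → Y i} (hp : ∀ i, Continuous (p i))
    (hsep : ∀ x y, x ≠ y → ∃ i, p i x ≠ p i y)
    (hmono : ∀ i j, i ≤ j → ∀ x y, p j x = p j y → p i x = p i y)
    (μ : ∀ i, Measure (Y i)) [∀ i, IsProbabilityMeasure (μ i)]
    (htight : ∀ ε : ℝ, 0 < ε → ∃ C : Set X, IsCompact C ∧
      ∀ i, ENNReal.ofReal (1 - ε) ≤ μ i (p i '' C))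
    (U : Ultrafilter ι) (hU : (U : Filter ι) ≤ atTop) :
    ∃ ν : Measure X, IsProbabilityMeasure ν ∧ ν.InnerRegular ∧
      ∀ O : Set X, IsOpen O → ∀ s : ∀ i, Set (Y i), (∀ᶠ i in U, p i '' O ⊆ s i) →
        ∀ ε : ℝ≥0∞, ε ≠ 0 → ∀ᶠ i in U, ν O ≤ μ i (s i) + ε := by
  obtain ⟨c, hc⟩ := exists_limit_content hp hsep hmono μ U hU
  -- On an open set the measure is the supremum of the content over compact subsets, and each of
  -- these values is a limit of masses inside `s i`.
  have hopen : ∀ O : Set X, IsOpen O → ∀ s : ∀ i, Set (Y i), (∀ᶠ i in U, p i '' O ⊆ s i) →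
      c.measure O ≤ liminf (fun i => μ i (s i)) U := by
    intro O hO s hs
    rw [c.measure_apply hO.measurableSet, c.outerMeasure_of_isOpen O hO]
    refine iSup₂_le fun C hCO => ?_
    rw [← (hc C).liminf_eq]
    refine liminf_le_liminf ?_
    filter_upwards [hs] with i hi
    exact measure_mono ((Set.image_mono hCO).trans hi)
  have hle1 : c.measure Set.univ ≤ 1 := by
    refine (hopen _ isOpen_univ (fun _ => Set.univ)
      (Eventually.of_forall fun _ => Set.subset_univ _)).trans ?_
    simp
  have hbig : ∀ ε : ℝ, 0 < ε → ∃ C : Set X, IsCompact C ∧ ENNReal.ofReal (1 - ε) ≤ c.measure C := by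
    intro ε hε
    obtain ⟨C, hC, h⟩ := htight ε hε
    refine ⟨C, hC, ?_⟩
    rw [c.measure_apply hC.measurableSet]
    exact (ge_of_tendsto' (hc ⟨C, hC⟩) h).trans (c.le_outerMeasure_compacts ⟨C, hC⟩)
  have huniv : c.measure Set.univ = 1 := by
    refine le_antisymm hle1 (ENNReal.le_of_forall_pos_le_add fun ε hε _ => ?_)
    obtain ⟨C, -, h⟩ := hbig ε hε
    calc (1 : ℝ≥0∞) = ENNReal.ofReal (1 - ε + ε) := by simp
      _ ≤ ENNReal.ofReal (1 - ε) + ENNReal.ofReal ε := ENNReal.ofReal_add_le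
      _ ≤ c.measure Set.univ + ε := by
        gcongr
        · exact h.trans (measure_mono (Set.subset_univ _))
        · simp
  have : IsProbabilityMeasure c.measure := ⟨huniv⟩
  refine ⟨c.measure, ‹_›, ?_, fun O hO s hs ε hε => ?_⟩
  swap
  -- Subtracting ε strictly decreases the mass only if the mass is nonzero.
  · rcases eq_or_ne (c.measure O) 0 with h0 | h0
    · exact Eventually.of_forall fun i => by simp [h0]
    · have hlt : c.measure O - ε < liminf (fun i => μ i (s i)) U :=
        (ENNReal.sub_lt_self (measure_ne_top _ _) h0 hε).trans_le (hopen O hO s hs)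
      filter_upwards [eventually_lt_of_lt_liminf hlt] with i hi
      exact tsub_le_iff_right.1 hi.le
  have : c.measure.OuterRegular := inferInstance
  refine innerRegular_of_outerRegular_of_tight _ fun ε hε => ?_
  obtain ⟨δ, hδ, hδε⟩ := ENNReal.lt_iff_exists_nnreal_btwn.1 (pos_iff_ne_zero.2 hε)
  obtain ⟨C, hC, h⟩ := hbig δ (by exact_mod_cast hδ)
  refine ⟨C, hC, ?_⟩
  rw [prob_compl_eq_one_sub hC.measurableSet, tsub_le_iff_right]
  calc (1 : ℝ≥0∞) = ENNReal.ofReal (δ + (1 - δ)) := by simp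
    _ ≤ ENNReal.ofReal δ + ENNReal.ofReal (1 - δ) := ENNReal.ofReal_add_le
    _ ≤ ε + c.measure C := by
      gcongr
      simpa using hδε.le

end ProjectiveTightness

/-! ### Comparing measures and integrals through open and superlevel sets -/

section Comparison

/-- A probability measure dominated on open sets by an inner regular one is equal to it. -/
theorem eq_of_le_on_isOpen {Y : Type*} [TopologicalSpace Y] [T2Space Y] [MeasurableSpace Y]
    [BorelSpace Y] {ν μ : Measure Y} [IsProbabilityMeasure ν] [IsProbabilityMeasure μ]
    (hμ : μ.InnerRegular) (h : ∀ O, IsOpen O → ν O ≤ μ O) : ν = μ := by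
  refine ext_of_generate_finite _ BorelSpace.measurable_eq isPiSystem_isOpen (fun O hO => ?_)
    (by simp)
  refine le_antisymm (h O hO) ?_
  rw [hO.measurableSet.measure_eq_iSup_isCompact]
  refine iSup₂_le fun C hCO => iSup_le fun hC => ?_
  -- Passing to complements reverses the inequality on compact sets; inner regularity of μ carries
  -- it back to O.
  have h1 := h Cᶜ hC.isClosed.isOpen_compl
  rw [prob_compl_eq_one_sub hC.measurableSet, prob_compl_eq_one_sub hC.measurableSet] at h1
  refine le_trans ?_ (measure_mono hCO)
  exact (ENNReal.sub_le_sub_iff_left prob_le_one ENNReal.one_ne_top).1 h1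

/-- Counting the integers `1, …, M` below `x` approximates `x` from below, up to one. -/
theorem card_filter_succ_lt (M : ℕ) (x : ℝ≥0) :
    ((Finset.range M).filter fun k : ℕ => ((k : ℝ≥0) + 1 < x)).card = min M (⌈x⌉₊ - 1) := by
  have : ((Finset.range M).filter fun k : ℕ => ((k : ℝ≥0) + 1 < x))
      = Finset.range (min M (⌈x⌉₊ - 1)) := by
    ext k
    have h : (k : ℝ≥0) + 1 < x ↔ k + 1 < ⌈x⌉₊ := by rw [Nat.lt_ceil]; push_cast; rfl
    simp only [Finset.mem_filter, Finset.mem_range, h, lt_min_iff]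
    omega
  rw [this, Finset.card_range]

/-- A discrete layer-cake formula. Only finitely many thresholds occur, so a condition holding
eventually at each of them holds eventually at all of them. -/
theorem lintegral_card_filter_succ_lt {X : Type*} [MeasurableSpace X] (ν : Measure X)
    {f : X → ℝ≥0} (hf : Measurable f) (M : ℕ) :
    ∫⁻ x, (min M (⌈f x⌉₊ - 1) : ℕ) ∂ν
      = ∑ k ∈ Finset.range M, ν {x | (k : ℝ≥0) + 1 < f x} := by
  have hm : ∀ k : ℕ, MeasurableSet {x | (k : ℝ≥0) + 1 < f x} := fun k =>
    measurableSet_lt measurable_const hf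
  simp_rw [← card_filter_succ_lt, Finset.card_filter]
  push_cast
  rw [lintegral_finsetSum' _ fun k _ => ?_]
  · refine Finset.sum_congr rfl fun k _ => ?_
    rw [← lintegral_indicator_one (hm k)]
    refine lintegral_congr fun x => ?_
    simp [Set.indicator_apply]
  · exact (Measurable.ite (hm k) measurable_const measurable_const).aemeasurable

/-- Rounding a function to integer heights costs at most 1 against a probability measure. After
truncation at M the superlevel inequalities are summed over M heights, and M tends to infinity by
monotone convergence. -/
theorem lintegral_le_add_one_of_superlevel {X ι : Type*} {Y : ι → Type*} [MeasurableSpace X]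
    [∀ i, MeasurableSpace (Y i)] {ν : Measure X} [IsProbabilityMeasure ν] {μ : ∀ i, Measure (Y i)}
    {U : Filter ι} [U.NeBot] {f : X → ℝ≥0} (hf : Measurable f) {g : ∀ i, Y i → ℝ≥0}
    {B : ℝ≥0∞} (hB : ∀ᶠ i in U, Measurable (g i) ∧ ∫⁻ y, g i y ∂μ i ≤ B)
    (h : ∀ t : ℝ≥0, ∀ ε : ℝ≥0∞, ε ≠ 0 →
      ∀ᶠ i in U, ν {x | t < f x} ≤ μ i {y | t < g i y} + ε) :
    ∫⁻ x, f x ∂ν ≤ B + 1 := by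
  have hM : ∀ M : ℕ, ∫⁻ x, min (M : ℝ≥0∞) (f x) ∂ν ≤ B + 1 := by
    intro M
    have hsum : ∑ k ∈ Finset.range M, ν {x | (k : ℝ≥0) + 1 < f x} ≤ B := by
      refine ENNReal.le_of_forall_pos_le_add fun ε hε _ => ?_
      -- For M = 0 this quotient is ∞, which is harmless because the sum is then empty.
      have hδ : (ε : ℝ≥0∞) / M ≠ 0 := by
        simp [hε.ne']
      have hall := (Finset.eventually_all (Finset.range M)).2 fun k _ => h ((k : ℝ≥0) + 1) _ hδ
      obtain ⟨i, hi, hgi, hBi⟩ := (hall.and hB).exists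
      calc ∑ k ∈ Finset.range M, ν {x | (k : ℝ≥0) + 1 < f x}
          ≤ ∑ k ∈ Finset.range M, (μ i {y | (k : ℝ≥0) + 1 < g i y} + ε / M) :=
            Finset.sum_le_sum fun k hk => hi k hk
        _ = ∫⁻ y, (min M (⌈g i y⌉₊ - 1) : ℕ) ∂μ i + M * (ε / M) := by
            rw [Finset.sum_add_distrib, lintegral_card_filter_succ_lt _ hgi]
            simp
        _ ≤ B + ε := by
            gcongr
            · refine (lintegral_mono fun y => ?_).trans hBi
              have : ((min M (⌈g i y⌉₊ - 1) : ℕ) : ℝ≥0) ≤ g i y := by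
                rcases Nat.eq_zero_or_pos (⌈g i y⌉₊ - 1) with h0 | h0
                · simp [h0]
                · refine le_trans (Nat.cast_le.2 (min_le_right _ _)) ?_
                  exact (Nat.lt_ceil.1 (by omega : ⌈g i y⌉₊ - 1 < ⌈g i y⌉₊)).le
              rw [← ENNReal.coe_natCast]
              exact ENNReal.coe_le_coe.2 this
            · exact ENNReal.mul_div_le
    calc ∫⁻ x, min (M : ℝ≥0∞) (f x) ∂ν
        ≤ ∫⁻ x, ((min M (⌈f x⌉₊ - 1) : ℕ) : ℝ≥0∞) + 1 ∂ν := by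
          refine lintegral_mono fun x => ?_
          have h1 : f x ≤ ((⌈f x⌉₊ - 1 : ℕ) : ℝ≥0) + 1 := by
            refine (Nat.le_ceil _).trans ?_
            exact_mod_cast (by omega : ⌈f x⌉₊ ≤ ⌈f x⌉₊ - 1 + 1)
          have h2 : min (M : ℝ≥0) (f x) ≤ ((min M (⌈f x⌉₊ - 1) : ℕ) : ℝ≥0) + 1 := by
            rw [Nat.cast_min, ← min_add_add_right]
            exact min_le_min (by simp) h1
          have h3 := ENNReal.coe_le_coe.2 h2
          rwa [ENNReal.coe_add, ENNReal.coe_min, ENNReal.coe_natCast, ENNReal.coe_natCast,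
            ENNReal.coe_one] at h3
      _ ≤ B + 1 := by
          rw [lintegral_add_right _ measurable_const, lintegral_card_filter_succ_lt _ hf]
          simpa using hsum
  have hsup : ∀ x, (f x : ℝ≥0∞) = ⨆ M : ℕ, min (M : ℝ≥0∞) (f x) := by
    intro x
    rw [← iSup_inf_eq, ENNReal.iSup_natCast, top_inf_eq]
  rw [lintegral_congr hsup, lintegral_iSup (fun M => measurable_const.min hf.coe_nnreal_ennreal)
    (fun M N hMN x => min_le_min_right _ (by exact_mod_cast hMN))]
  exact iSup_le hM

/-- Lower semicontinuity of the integral of a nonnegative function, from the corresponding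
inequality for its superlevel sets. -/
theorem lintegral_le_of_superlevel {X ι : Type*} {Y : ι → Type*} [MeasurableSpace X]
    [∀ i, MeasurableSpace (Y i)] {ν : Measure X} [IsProbabilityMeasure ν] {μ : ∀ i, Measure (Y i)}
    {U : Filter ι} [U.NeBot] {f : X → ℝ≥0} (hf : Measurable f) {g : ∀ i, Y i → ℝ≥0}
    {B : ℝ≥0∞} (hB : ∀ᶠ i in U, Measurable (g i) ∧ ∫⁻ y, g i y ∂μ i ≤ B)
    (h : ∀ t : ℝ≥0, ∀ ε : ℝ≥0∞, ε ≠ 0 →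
      ∀ᶠ i in U, ν {x | t < f x} ≤ μ i {y | t < g i y} + ε) :
    ∫⁻ x, f x ∂ν ≤ B := by
  have hn : ∀ n : ℕ, n ≠ 0 → ∫⁻ x, f x ∂ν ≤ B + (n : ℝ≥0∞)⁻¹ := by
    intro n hn
    have hn' : (0 : ℝ≥0) < n := by positivity
    -- Scaling by n turns the rounding error 1 into 1/n.
    have key := lintegral_le_add_one_of_superlevel (U := U) (ν := ν) (μ := μ)
      (f := fun x => n * f x) (g := fun i y => n * g i y) (B := n * B) (hf.const_mul _) ?_ ?_
    · simp only [ENNReal.coe_mul, ENNReal.coe_natCast] at key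
      rw [lintegral_const_mul _ hf.coe_nnreal_ennreal] at key
      have h0 : (n : ℝ≥0∞) ≠ 0 := by simpa using hn
      have ht : (n : ℝ≥0∞) ≠ ∞ := ENNReal.natCast_ne_top n
      rw [← ENNReal.mul_le_mul_iff_right h0 ht, mul_add, ENNReal.mul_inv_cancel h0 ht]
      exact key
    · filter_upwards [hB] with i hi
      refine ⟨hi.1.const_mul _, ?_⟩
      simp only [ENNReal.coe_mul, ENNReal.coe_natCast]
      rw [lintegral_const_mul _ hi.1.coe_nnreal_ennreal]
      gcongr
      exact hi.2
    · intro t ε hε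
      simpa only [div_lt_iff₀' hn'] using h (t / n) ε hε
  refine ENNReal.le_of_forall_pos_le_add fun ε hε _ => ?_
  obtain ⟨n, hn0, hnε⟩ := ENNReal.exists_inv_nat_lt (ENNReal.coe_ne_zero.2 hε.ne') |>.imp
    fun n hn => (⟨fun h => by simp [h] at hn, hn⟩ : n ≠ 0 ∧ _)
  exact (hn n hn0).trans (by gcongr)

end Comparison

/-! ### Character spaces as real zero sets in powers of ℝ -/

section Generators

variable {B σ : Type*} [CommRing B] [Algebra ℝ B] {g : σ → B}

theorem aeval_surjective_of_adjoin_range (hg : Algebra.adjoin ℝ (Set.range g) = ⊤) :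
    Function.Surjective (MvPolynomial.aeval g : MvPolynomial σ ℝ →ₐ[ℝ] B) := by
  rw [← AlgHom.range_eq_top, ← Algebra.adjoin_range_eq_range_aeval, hg]

theorem isInducing_eval : IsInducing fun (α : CharSpace B) (b : B) => α b := ⟨rfl⟩

/-- Evaluation at a generating family identifies `X(B)` with a closed subset of a power of `ℝ`. -/
theorem isClosedEmbedding_eval_generators (hg : Algebra.adjoin ℝ (Set.range g) = ⊤) :
    IsClosedEmbedding fun (α : CharSpace B) (i : σ) => α (g i) := by
  have hsurj := aeval_surjective_of_adjoin_range hg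
  have hcont : Continuous fun (α : CharSpace B) (i : σ) => α (g i) :=
    continuous_pi fun i => continuous_eval (g i)
  choose P hP using hsurj
  have hval : ∀ (α : CharSpace B) (p : MvPolynomial σ ℝ),
      α (MvPolynomial.aeval g p) = MvPolynomial.eval (fun i => α (g i)) p := by
    intro α p
    rw [MvPolynomial.comp_aeval_apply, ← MvPolynomial.coe_aeval_eq_eval]
    rfl
  refine ⟨⟨?_, ?_⟩, ?_⟩
  -- Each evaluation is a polynomial in the coordinates at the generators, so these coordinates
  -- already induce the topology.
  · refine IsInducing.of_comp hcont
      (g := fun (x : σ → ℝ) (b : B) => MvPolynomial.eval x (P b))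
      (continuous_pi fun b => MvPolynomial.continuous_eval _) ?_
    convert! isInducing_eval (B := B) using 1
    ext α b
    rw [Function.comp_apply, ← hval, hP]
  · intro α β h
    ext b
    rw [← hP b, hval, hval]
    exact congrArg (fun x => MvPolynomial.eval x (P b)) h
  -- The image is the common zero set of the relations among the generators: a point satisfying all
  -- of them defines a character on the quotient.
  · have : Set.range (fun (α : CharSpace B) (i : σ) => α (g i))
        = ⋂ p ∈ {p : MvPolynomial σ ℝ | MvPolynomial.aeval g p = 0},
          {x | MvPolynomial.eval x p = 0} := by
      ext x
      simp only [Set.mem_iInter, Set.mem_ofPred_eq]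
      constructor
      · rintro ⟨α, rfl⟩ p hp
        rw [← hval, hp, map_zero]
      · intro hx
        refine ⟨AlgHom.liftOfSurjective (MvPolynomial.aeval g)
          (aeval_surjective_of_adjoin_range hg) (MvPolynomial.aeval x) fun p hp => ?_, ?_⟩
        · have := hx p hp
          rwa [← MvPolynomial.coe_aeval_eq_eval] at this
        · ext i
          have := AlgHom.liftOfSurjective_apply (MvPolynomial.aeval g)
            (aeval_surjective_of_adjoin_range hg) (MvPolynomial.aeval x) (fun p hp => by
              have := hx p hp
              rwa [← MvPolynomial.coe_aeval_eq_eval] at this) (MvPolynomial.X i)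
          simpa using this
    rw [this]
    exact isClosed_biInter fun p _ => isClosed_eq (MvPolynomial.continuous_eval p) continuous_const

/-- Finite Borel measures on the character space of a countably generated algebra are Radon. -/
theorem isRadon_of_countably_generated [Countable σ]
    (hg : Algebra.adjoin ℝ (Set.range g) = ⊤) (μ : Measure (CharSpace B)) [IsFiniteMeasure μ] :
    IsRadon μ := by
  have : PolishSpace (CharSpace B) := (isClosedEmbedding_eval_generators hg).polishSpace
  exact ⟨inferInstance, inferInstance⟩

/-- A map into the character space of a countably generated algebra is measurable as soon as its
compositions with the evaluations at generators are. -/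
theorem measurable_of_eval_generators [Countable σ]
    (hg : Algebra.adjoin ℝ (Set.range g) = ⊤) {Ω : Type*} [MeasurableSpace Ω]
    {f : Ω → CharSpace B} (hf : ∀ i, Measurable fun ω => f ω (g i)) : Measurable f :=
  (isClosedEmbedding_eval_generators hg).measurableEmbedding.measurable_comp_iff.1
    (measurable_pi_iff.2 hf)

end Generators

/-! ### Restriction maps and countably generated subalgebras -/

section Restriction

variable {A : Type*} [CommRing A] [Algebra ℝ A]

theorem res_apply (S : Subalgebra ℝ A) (α : CharSpace A) (s : S) : res S α s = α s := rfl

theorem resLE_comp_resLE {S T V : Subalgebra ℝ A} (h : S ≤ T) (h' : T ≤ V) :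
    resLE h ∘ resLE h' = resLE (h.trans h') := rfl

theorem measurable_res (S : Subalgebra ℝ A) : Measurable (res S) := (continuous_res S).measurable

theorem measurable_resLE {S T : Subalgebra ℝ A} (h : S ≤ T) : Measurable (resLE h) :=
  (continuous_resLE h).measurable

theorem map_resLE_map_resLE {S T V : Subalgebra ℝ A} (h : S ≤ T) (h' : T ≤ V)
    (μ : Measure (CharSpace V)) :
    (μ.map (resLE h')).map (resLE h) = μ.map (resLE (h.trans h')) := by
  rw [Measure.map_map (measurable_resLE h) (measurable_resLE h'), resLE_comp_resLE]

theorem isProbabilityMeasure_map_resLE {S T : Subalgebra ℝ A} (h : S ≤ T)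
    (μ : Measure (CharSpace T)) [IsProbabilityMeasure μ] :
    IsProbabilityMeasure (μ.map (resLE h)) :=
  Measure.isProbabilityMeasure_map (measurable_resLE h).aemeasurable

/-- The finitely generated subalgebra generated by finitely many elements. -/
def adjoinFinset (F : Finset A) : FGSub A :=
  ⟨Algebra.adjoin ℝ (F : Set A), Subalgebra.fg_adjoin_finset F⟩

instance : Nonempty (FGSub A) := ⟨adjoinFinset ∅⟩

instance : IsDirectedOrder (FGSub A) :=
  ⟨fun S T => ⟨⟨S.1 ⊔ T.1, S.2.sup T.2⟩, (le_sup_left : S.1 ≤ _), (le_sup_right : T.1 ≤ _)⟩⟩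

theorem mem_adjoinFinset_singleton (a : A) : a ∈ (adjoinFinset {a}).1 :=
  Algebra.subset_adjoin (by simp)

theorem FGSub.countably_generated (S : FGSub A) :
    ∃ G : Set A, G.Countable ∧ Algebra.adjoin ℝ G = S.1 := by
  obtain ⟨F, hF, h⟩ := Subalgebra.fg_def.1 S.2
  exact ⟨F, hF.countable, h⟩

/-- A countably generated subalgebra, seen as an algebra, has a sequence of generators. -/
theorem CGSub.exists_generators (T : CGSub A) :
    ∃ g : ℕ → T.1, Algebra.adjoin ℝ (Set.range g) = ⊤ := by
  obtain ⟨T, G, hG, rfl⟩ := T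
  -- Inserting 0 makes the set nonempty, as the range of a sequence must be.
  obtain ⟨g, hg⟩ := ((hG.preimage (Subtype.val_injective (p := (· ∈ Algebra.adjoin ℝ G)))).insert
    0).exists_eq_range (Set.insert_nonempty _ _)
  refine ⟨g, ?_⟩
  rw [← hg, eq_top_iff, ← Algebra.adjoin_adjoin_coe_preimage]
  exact Algebra.adjoin_mono (Set.subset_insert _ _)

theorem CGSub.isRadon (T : CGSub A) (μ : Measure (CharSpace T.1)) [IsFiniteMeasure μ] :
    IsRadon μ := by
  obtain ⟨g, hg⟩ := T.exists_generators
  exact isRadon_of_countably_generated hg μ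

theorem FGSub.isRadon (S : FGSub A) (μ : Measure (CharSpace S.1)) [IsFiniteMeasure μ] :
    IsRadon μ :=
  CGSub.isRadon ⟨S.1, S.countably_generated⟩ μ

theorem measurable_res_cylinderSigma_of_fg (S : FGSub A) :
    Measurable[cylinderSigma A] (res S.1) := by
  intro M hM
  exact MeasurableSpace.measurableSet_iSup.2
    (MeasurableSpace.measurableSet_generateFrom ⟨S, M, hM, rfl⟩)

theorem measurable_eval_cylinderSigma (a : A) :
    Measurable[cylinderSigma A] fun α : CharSpace A => α a :=
  (continuous_eval (⟨a, mem_adjoinFinset_singleton a⟩ : (adjoinFinset {a}).1)).measurable.comp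
    (measurable_res_cylinderSigma_of_fg (adjoinFinset {a}))

/-- Measurability into X(T) can be tested on countably many generators, and each single evaluation
factors through a finitely generated subalgebra. -/
theorem measurable_res_cylinderSigma (T : CGSub A) : Measurable[cylinderSigma A] (res T.1) := by
  obtain ⟨g, hg⟩ := T.exists_generators
  exact @measurable_of_eval_generators _ _ _ _ _ _ hg _ (cylinderSigma A) _ fun i =>
    measurable_eval_cylinderSigma (g i : A)

/-- A probability measure on the character space of a countably generated subalgebra is determined
by its projections to finitely generated subalgebras. -/
theorem CGSub.measure_ext (T : CGSub A) {ν ν' : Measure (CharSpace T.1)} [IsFiniteMeasure ν]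
    [IsFiniteMeasure ν']
    (h : ∀ (S : FGSub A) (hS : S.1 ≤ T.1), ν.map (resLE hS) = ν'.map (resLE hS)) : ν = ν' := by
  classical
  obtain ⟨g, hg⟩ := T.exists_generators
  have he := (isClosedEmbedding_eval_generators hg).measurableEmbedding
  set e := fun (α : CharSpace T.1) (i : ℕ) => α (g i) with he_def
  -- Finitely many coordinates factor through the subalgebra generated by the corresponding
  -- generators, so the finite-dimensional marginals in ℝ^ℕ agree.
  have hproj : ∀ J : Finset ℕ, (ν.map e).map J.restrict = (ν'.map e).map J.restrict := by
    intro J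
    have hJT : (adjoinFinset (J.image fun i => (g i : A))).1 ≤ T.1 :=
      Algebra.adjoin_le fun a ha => by
        obtain ⟨i, -, rfl⟩ := Finset.mem_image.1 (Finset.mem_coe.1 ha)
        exact (g i).2
    have hmem : ∀ i : J, (g i : A) ∈ (adjoinFinset (J.image fun i => (g i : A))).1 := fun i =>
      Algebra.subset_adjoin (Finset.mem_coe.2 (Finset.mem_image_of_mem _ i.2))
    let r : CharSpace (adjoinFinset (J.image fun i => (g i : A))).1 → (J → ℝ) :=
      fun α i => α ⟨g i, hmem i⟩
    have hr : Measurable r := (continuous_pi fun i => continuous_eval _).measurable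
    have hcomp : J.restrict ∘ e = r ∘ resLE hJT := rfl
    rw [Measure.map_map (Finset.measurable_restrict J) he.measurable,
      Measure.map_map (Finset.measurable_restrict J) he.measurable, hcomp,
      ← Measure.map_map hr (measurable_resLE _), ← Measure.map_map hr (measurable_resLE _), h]
  have hmap : ν.map e = ν'.map e :=
    IsProjectiveLimit.unique (P := fun J => (ν'.map e).map J.restrict) hproj fun _ => rfl
  rw [← he.comap_map ν, hmap, he.comap_map]

end Restriction

variable {A : Type*} [CommRing A] [Algebra ℝ A]

/-! ### Inverse limits along towers of finitely generated subalgebras -/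

section Tower

/-- A countably generated subalgebra is exhausted by a sequence of finitely generated ones. -/
theorem CGSub.exists_tower (T : CGSub A) : ∃ S : ℕ → FGSub A, Monotone S ∧
    (∀ n, (S n).1 ≤ T.1) ∧ ∀ a ∈ T.1, ∃ n, a ∈ (S n).1 := by
  classical
  obtain ⟨g, hg⟩ := T.exists_generators
  let S : ℕ → FGSub A := fun n => adjoinFinset ((Finset.range n).image fun i => (g i : A))
  have hmono : Monotone S := fun m n hmn =>
    Algebra.adjoin_mono (by exact_mod_cast Finset.image_subset_image (Finset.range_mono hmn))
  refine ⟨S, hmono, fun n => Algebra.adjoin_le fun a ha => ?_, fun a ha => ?_⟩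
  · obtain ⟨i, -, rfl⟩ := Finset.mem_image.1 (Finset.mem_coe.1 ha)
    exact (g i).2
  · have hdir : Directed (· ≤ ·) fun n => (S n).1 := Monotone.directed_le hmono
    have hT : T.1 ≤ ⨆ n, (S n).1 := by
      have h1 : (Algebra.adjoin ℝ (Set.range g)).map T.1.val = T.1 := by
        rw [hg, Algebra.map_top, Subalgebra.range_val]
      rw [← h1, AlgHom.map_adjoin]
      refine Algebra.adjoin_le ?_
      rintro _ ⟨_, ⟨i, rfl⟩, rfl⟩
      refine le_iSup (fun n => (S n).1) (i + 1) (Algebra.subset_adjoin ?_)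
      exact Finset.mem_coe.2 (Finset.mem_image.2 ⟨i, by simp, rfl⟩)
    have := hT ha
    rw [← SetLike.mem_coe, Subalgebra.coe_iSup_of_directed hdir] at this
    simpa using this

variable {T : Subalgebra ℝ A} {S : ℕ → FGSub A}

theorem exists_le_of_fg (hmono : Monotone S) (hcov : ∀ a ∈ T, ∃ n, a ∈ (S n).1)
    (S' : FGSub A) (h : S'.1 ≤ T) : ∃ n, S'.1 ≤ (S n).1 := by
  obtain ⟨F, hF, hFS⟩ := Subalgebra.fg_def.1 S'.2
  have hev : ∀ a ∈ F, ∀ᶠ n in atTop, a ∈ (S n).1 := by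
    intro a ha
    obtain ⟨n, hn⟩ := hcov a (h (hFS ▸ Algebra.subset_adjoin ha))
    filter_upwards [eventually_ge_atTop n] with m hm
    exact (show (S n).1 ≤ (S m).1 from hmono hm) hn
  obtain ⟨n, hn⟩ := ((eventually_all_finite hF).2 hev).exists
  exact ⟨n, hFS ▸ Algebra.adjoin_le hn⟩

/-- Compatible characters on the members of a tower glue to a character on its union. -/
theorem exists_glue (hmono : Monotone S) (hST : ∀ n, (S n).1 ≤ T)
    (hcov : ∀ a ∈ T, ∃ n, a ∈ (S n).1) (x : ∀ n, CharSpace (S n).1)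
    (hx : ∀ m n (h : m ≤ n), resLE (hmono h) (x n) = x m) :
    ∃ α : CharSpace T, ∀ n, resLE (hST n) α = x n := by
  have hdir : Directed (· ≤ ·) fun n => (S n).1 := Monotone.directed_le hmono
  have hT : T ≤ ⨆ n, (S n).1 := by
    intro a ha
    obtain ⟨n, hn⟩ := hcov a ha
    exact le_iSup (fun n => (S n).1) n hn
  refine ⟨Subalgebra.iSupLift (fun n => (S n).1) hdir x (fun i j h => ?_) T hT, fun n =>
    Subalgebra.iSupLift_comp_inclusion (K := fun n => (S n).1) (hST n)⟩
  rcases le_total i j with hij | hij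
  · exact (hx i j hij).symm
  · rw [← hx j i hij]
    rfl

theorem tendsto_nhds_of_tendsto_resLE {κ : Type*} {l : Filter κ} (hST : ∀ n, (S n).1 ≤ T)
    (hcov : ∀ a ∈ T, ∃ n, a ∈ (S n).1) {f : κ → CharSpace T} {α : CharSpace T}
    (h : ∀ n, Tendsto (fun i => resLE (hST n) (f i)) l (𝓝 (resLE (hST n) α))) :
    Tendsto f l (𝓝 α) := by
  rw [isInducing_eval.tendsto_nhds_iff, tendsto_pi_nhds]
  intro b
  obtain ⟨n, hn⟩ := hcov b b.2
  exact ((continuous_eval (⟨b, hn⟩ : (S n).1)).tendsto _).comp (h n)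

/-- Limits along an ultrafilter of eventually defined compatible families of characters. -/
theorem exists_limit_of_tower (hmono : Monotone S) (hST : ∀ n, (S n).1 ≤ T)
    (hcov : ∀ a ∈ T, ∃ n, a ∈ (S n).1) {κ : Type*} (U : Ultrafilter κ)
    (z : κ → ∀ n, CharSpace (S n).1) {C : ∀ n, Set (CharSpace (S n).1)}
    (hC : ∀ n, IsCompact (C n)) (hz : ∀ n, ∀ᶠ i in U, z i n ∈ C n)
    (hcompat : ∀ m n (h : m ≤ n), ∀ᶠ i in U, resLE (hmono h) (z i n) = z i m) :
    ∃ α : CharSpace T, (∀ n, resLE (hST n) α ∈ C n) ∧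
      ∀ n, Tendsto (fun i => z i n) U (𝓝 (resLE (hST n) α)) := by
  have hlim : ∀ n, ∃ x ∈ C n, Tendsto (fun i => z i n) U (𝓝 x) := fun n =>
    (hC n).ultrafilter_le_nhds (U.map fun i => z i n) (by
      rw [le_principal_iff]
      exact mem_map.2 (hz n))
  choose x hxC hx using hlim
  obtain ⟨α, hα⟩ := exists_glue hmono hST hcov x fun m n h =>
    tendsto_nhds_unique_of_eventuallyEq (((continuous_resLE (hmono h)).tendsto _).comp (hx n))
      (hx m) (hcompat m n h)
  exact ⟨α, fun n => hα n ▸ hxC n, fun n => hα n ▸ hx n⟩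

/-- An ultrafilter on this set converges at every stage, and the stagewise limits glue to a
character on the union. -/
theorem isCompact_setOf_forall_resLE_mem (hmono : Monotone S) (hST : ∀ n, (S n).1 ≤ T)
    (hcov : ∀ a ∈ T, ∃ n, a ∈ (S n).1) {C : ∀ n, Set (CharSpace (S n).1)}
    (hC : ∀ n, IsCompact (C n)) :
    IsCompact {α : CharSpace T | ∀ n, resLE (hST n) α ∈ C n} := by
  rw [isCompact_iff_ultrafilter_le_nhds]
  intro V hV
  have hmem : ∀ᶠ α in V, ∀ n, resLE (hST n) α ∈ C n := le_principal_iff.1 hV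
  obtain ⟨α, hαC, hα⟩ := exists_limit_of_tower hmono hST hcov V
    (fun α n => resLE (hST n) α) hC (fun n => hmem.mono fun α h => h n)
    (fun m n h => Eventually.of_forall fun α => rfl)
  exact ⟨α, hαC, tendsto_nhds_of_tendsto_resLE (f := id) hST hcov hα⟩

/-- A point that lifts to every finite stage of an inverse system of compact sets lifts to the
inverse limit. -/
theorem exists_lift_of_forall_stage (hmono : Monotone S) (hST : ∀ n, (S n).1 ≤ T)
    (hcov : ∀ a ∈ T, ∃ n, a ∈ (S n).1) {C : ∀ n, Set (CharSpace (S n).1)}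
    (hC : ∀ n, IsCompact (C n)) (n : ℕ) (y : CharSpace (S n).1)
    (hy : ∀ j, ∃ d : CharSpace (S (n + j)).1,
      (∀ k (h : k ≤ n + j), resLE (hmono h) d ∈ C k) ∧ resLE (hmono (Nat.le_add_right n j)) d = y) :
    ∃ α : CharSpace T, (∀ k, resLE (hST k) α ∈ C k) ∧ resLE (hST n) α = y := by
  choose d hdC hdy using hy
  -- The point `d j` lives only on stage n + j. Beyond it a dummy value taken from `d k` makes the
  -- family total; for fixed k it disappears once j ≥ k.
  let z : ℕ → ∀ k, CharSpace (S k).1 := fun j k =>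
    if h : k ≤ n + j then resLE (hmono h) (d j)
    else resLE (hmono (Nat.le_add_left k n)) (d k)
  have hz : ∀ k, ∀ᶠ j in atTop, ∃ h : k ≤ n + j, z j k = resLE (hmono h) (d j) := by
    intro k
    filter_upwards [eventually_ge_atTop k] with j hj
    have h : k ≤ n + j := by omega
    exact ⟨h, dif_pos h⟩
  have hU : ((Ultrafilter.of atTop : Ultrafilter ℕ) : Filter ℕ) ≤ atTop := Ultrafilter.of_le _
  obtain ⟨α, hαC, hα⟩ := exists_limit_of_tower hmono hST hcov (Ultrafilter.of atTop) z hC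
    (fun k => hU ((hz k).mono fun j ⟨h, hj⟩ => hj ▸ hdC j k h))
    (fun k l hkl => hU (((hz k).and (hz l)).mono fun j ⟨⟨h, hj⟩, ⟨h', hj'⟩⟩ => by
      rw [hj, hj']
      rfl))
  refine ⟨α, hαC, tendsto_nhds_unique_of_eventuallyEq (hα n) tendsto_const_nhds
    (hU ((hz n).mono fun j ⟨h, hj⟩ => ?_))⟩
  exact hj.trans (hdy j)

end Tower

/-! ### Kolmogorov extension to countably generated subalgebras -/

section Extension

theorem IsRadon.exists_isCompact_ge {X : Type*} [TopologicalSpace X] [MeasurableSpace X]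
    {μ : Measure X} [IsProbabilityMeasure μ] (hμ : IsRadon μ) {δ : ℝ≥0∞} (hδ : δ ≠ 0) :
    ∃ C, IsCompact C ∧ 1 - δ ≤ μ C := by
  have := hμ.innerRegular
  have h1 : 1 - δ < μ Set.univ := by
    rw [measure_univ]
    exact ENNReal.sub_lt_self ENNReal.one_ne_top one_ne_zero hδ
  obtain ⟨C, -, hC, h⟩ := MeasurableSet.univ.exists_lt_isCompact h1
  exact ⟨C, hC, h.le⟩

theorem prob_compl_le_of_ge {X : Type*} [MeasurableSpace X] {μ : Measure X}
    [IsProbabilityMeasure μ] {C : Set X} (hC : MeasurableSet C) {δ : ℝ≥0∞} (h : 1 - δ ≤ μ C) :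
    μ Cᶜ ≤ δ := by
  rw [prob_compl_eq_one_sub hC, tsub_le_iff_left]
  exact tsub_le_iff_right.1 h

variable {S : ℕ → FGSub A} {μ : ∀ S : FGSub A, Measure (CharSpace S.1)}

/-- An exact sequence of Radon probability measures is mostly carried by a compact set at every
stage, compatibly with the projections. -/
theorem prob_stage_ge (hmono : Monotone S)
    [∀ S, IsProbabilityMeasure (μ S)] (hex : IsExact μ) {C : ∀ n, Set (CharSpace (S n).1)}
    (hC : ∀ n, IsCompact (C n)) {δ : ℕ → ℝ≥0∞} {ε : ℝ≥0∞}
    (hCδ : ∀ n, μ (S n) (C n)ᶜ ≤ δ n) (hδ : ∑' n, δ n ≤ ε) (m : ℕ) :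
    1 - ε ≤ μ (S m) {d | ∀ k (h : k ≤ m), resLE (hmono h) d ∈ C k} := by
  have hmeas : MeasurableSet {d | ∀ k (h : k ≤ m), resLE (hmono h) d ∈ C k} := by
    simp only [Set.ofPred_forall]
    exact MeasurableSet.iInter fun k => MeasurableSet.iInter fun h =>
      measurable_resLE (hmono h) (hC k).measurableSet
  have hcompl : μ (S m) {d | ∀ k (h : k ≤ m), resLE (hmono h) d ∈ C k}ᶜ ≤ ε := by
    refine le_trans ((measure_mono ?_).trans (measure_iUnion_le
      (fun k => {d | ∃ h : k ≤ m, resLE (hmono h) d ∉ C k}))) ((ENNReal.tsum_le_tsum ?_).trans hδ)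
    · intro d hd
      simpa using hd
    · intro k
      by_cases h : k ≤ m
      · refine le_trans (le_of_eq ?_) (hCδ k)
        rw [← hex (S k) (S m) (hmono h),
          Measure.map_apply (measurable_resLE _) (hC k).measurableSet.compl]
        congr 1
        ext d
        simp [h]
      · simp [h]
  rw [tsub_le_iff_right, ← prob_add_prob_compl (μ := μ (S m)) hmeas]
  gcongr

/-- This is the tightness required by `exists_innerRegular_limit`. Compact sets missing mass δ n,
with the δ n summing to less than ε, cut out a compact set in the inverse limit. -/
theorem exists_isCompact_of_isExact {T : Subalgebra ℝ A} (hmono : Monotone S)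
    (hST : ∀ n, (S n).1 ≤ T) (hcov : ∀ a ∈ T, ∃ n, a ∈ (S n).1)
    [∀ S, IsProbabilityMeasure (μ S)] (hrad : ∀ S, IsRadon (μ S)) (hex : IsExact μ)
    {ε : ℝ} (hε : 0 < ε) :
    ∃ C : Set (CharSpace T), IsCompact C ∧
      ∀ n, ENNReal.ofReal (1 - ε) ≤ μ (S n) (resLE (hST n) '' C) := by
  obtain ⟨δ, hδ0, hδ⟩ := ENNReal.exists_pos_sum_of_countable'
    (ENNReal.ofReal_pos.2 hε).ne' ℕ
  have hex' : ∀ n, ∃ C : Set (CharSpace (S n).1), IsCompact C ∧ μ (S n) Cᶜ ≤ δ n := by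
    intro n
    obtain ⟨C, hC, h⟩ := (hrad (S n)).exists_isCompact_ge (hδ0 n).ne'
    exact ⟨C, hC, prob_compl_le_of_ge hC.measurableSet h⟩
  choose C hC hCδ using hex'
  refine ⟨_, isCompact_setOf_forall_resLE_mem hmono hST hcov hC, fun n => ?_⟩
  set D : ∀ m, Set (CharSpace (S m).1) := fun m => {d | ∀ k (h : k ≤ m), resLE (hmono h) d ∈ C k}
    with hD
  have hDcompact : ∀ m, IsCompact (D m) := by
    intro m
    refine (hC m).of_isClosed_subset ?_ fun d hd => hd m le_rfl
    simp only [hD, Set.ofPred_forall]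
    exact isClosed_iInter fun k => isClosed_iInter fun h =>
      (hC k).isClosed.preimage (continuous_resLE (hmono h))
  set E : ℕ → Set (CharSpace (S n).1) := fun j => resLE (hmono (Nat.le_add_right n j)) '' D (n + j)
    with hE
  have hEcompact : ∀ j, IsCompact (E j) := fun j => (hDcompact _).image (continuous_resLE _)
  have hEanti : Antitone E := by
    intro i j hij
    rintro _ ⟨d, hd, rfl⟩
    exact ⟨resLE (hmono (Nat.add_le_add_left hij n)) d, fun k h => hd k (by omega), rfl⟩
  -- A point of stage n that lifts to every later stage lifts to the limit, so the image has at
  -- least the mass of this decreasing intersection.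
  have hsub : ⋂ j, E j ⊆ resLE (hST n) '' {α | ∀ k, resLE (hST k) α ∈ C k} := by
    intro y hy
    obtain ⟨α, hα, hαy⟩ := exists_lift_of_forall_stage hmono hST hcov hC n y fun j =>
      (Set.mem_iInter.1 hy j)
    exact ⟨α, hα, hαy⟩
  refine le_trans ?_ (measure_mono hsub)
  rw [hEanti.measure_iInter (fun j => (hEcompact j).measurableSet.nullMeasurableSet)
    ⟨0, measure_ne_top _ _⟩]
  refine le_iInf fun j => ?_
  rw [ENNReal.ofReal_sub _ hε.le, ENNReal.ofReal_one]
  refine (prob_stage_ge hmono hex hC hCδ hδ.le (n + j)).trans ?_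
  rw [← hex (S n) (S (n + j)) (hmono (Nat.le_add_right n j)),
    Measure.map_apply (measurable_resLE _) (hEcompact j).measurableSet]
  exact measure_mono (Set.subset_preimage_image _ _)

/-- Kolmogorov extension to the character space of a countably generated subalgebra. -/
theorem CGSub.exists_extension (T : CGSub A) [∀ S, IsProbabilityMeasure (μ S)]
    (hrad : ∀ S, IsRadon (μ S)) (hex : IsExact μ) :
    ∃ ν : Measure (CharSpace T.1), IsProbabilityMeasure ν ∧
      ∀ (S : FGSub A) (h : S.1 ≤ T.1), ν.map (resLE h) = μ S := by
  obtain ⟨S, hmono, hST, hcov⟩ := T.exists_tower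
  obtain ⟨ν, hν, -, hlim⟩ := exists_innerRegular_limit (X := CharSpace T.1)
    (p := fun n => resLE (hST n)) (fun n => continuous_resLE (hST n))
    (fun x y hxy => by
      by_contra! hall
      refine hxy (AlgHom.ext fun b => ?_)
      obtain ⟨n, hn⟩ := hcov b b.2
      exact DFunLike.congr_fun (hall n) ⟨b, hn⟩)
    (fun i j hij x y h => congrArg (resLE (hmono hij)) h)
    (fun n => μ (S n)) (fun ε hε => exists_isCompact_of_isExact hmono hST hcov hrad hex hε)
    (Ultrafilter.of atTop) (Ultrafilter.of_le _)
  have hstage : ∀ n, ν.map (resLE (hST n)) = μ (S n) := by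
    intro n
    have := isProbabilityMeasure_map_resLE (hST n) ν
    refine eq_of_le_on_isOpen (hrad (S n)).innerRegular fun O hO => ?_
    rw [Measure.map_apply (measurable_resLE _) hO.measurableSet]
    refine ENNReal.le_of_forall_pos_le_add fun ε hε _ => ?_
    have h1 := hlim _ (hO.preimage (continuous_resLE (hST n)))
      -- The condition is vacuous for i < n; for i ≥ n exactness gives this set the mass μ (S n) O.
      (fun i => {y | ∀ h : n ≤ i, resLE (hmono h) y ∈ O})
      (Eventually.of_forall fun i => by
        rintro _ ⟨α, hα, rfl⟩ h
        exact hα) ε (ENNReal.coe_ne_zero.2 hε.ne')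
    obtain ⟨i, hi, hni⟩ := (h1.and (Ultrafilter.of_le atTop (eventually_ge_atTop n))).exists
    refine hi.trans (le_of_eq ?_)
    rw [← hex (S n) (S i) (hmono hni), Measure.map_apply (measurable_resLE _) hO.measurableSet]
    congr 2
    ext y
    simp [hni]
  refine ⟨ν, hν, fun S' h => ?_⟩
  obtain ⟨n, hn⟩ := exists_le_of_fg hmono hcov S' h
  rw [← hex S' (S n) hn, ← hstage n, map_resLE_map_resLE]

end Extension

/-! ### The induced family -/

section Induced

variable {μ : ∀ S : FGSub A, Measure (CharSpace S.1)}

theorem IsInduced.isExact {ν : ∀ T : CGSub A, Measure (CharSpace T.1)} (h : IsInduced μ ν) :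
    IsExact ν := by
  intro T₁ T₂ h12
  have := (h T₁).2.1
  have := (h T₂).2.1
  have := isProbabilityMeasure_map_resLE h12 (ν T₂)
  refine CGSub.measure_ext T₁ fun S hS => ?_
  rw [map_resLE_map_resLE, (h T₁).2.2 S hS, (h T₂).2.2 S (hS.trans h12)]

theorem IsInduced.unique {ν ν' : ∀ T : CGSub A, Measure (CharSpace T.1)} (h : IsInduced μ ν)
    (h' : IsInduced μ ν') : ν = ν' := by
  funext T
  have := (h T).2.1
  have := (h' T).2.1
  exact CGSub.measure_ext T fun S hS => by rw [(h T).2.2 S hS, (h' T).2.2 S hS]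

theorem exists_isInduced [∀ S, IsProbabilityMeasure (μ S)] (hrad : ∀ S, IsRadon (μ S))
    (hex : IsExact μ) : ∃ ν : ∀ T : CGSub A, Measure (CharSpace T.1), IsInduced μ ν := by
  choose ν hν hproj using fun T : CGSub A => T.exists_extension hrad hex
  exact ⟨ν, fun T => ⟨T.isRadon _, hν T, hproj T⟩⟩

end Induced

/-! ### Representing measures under restriction -/

section Representing

/-- Testing against 1 gives the real value of the total mass; an infinite mass would have real value
0, not 1. -/
theorem IsRepresenting.isProbabilityMeasure {B : Type*} [CommRing B] [Algebra ℝ B]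
    {L : B →ₗ[ℝ] ℝ} (hL : L 1 = 1) {K : Set (CharSpace B)} {m : MeasurableSpace (CharSpace B)}
    {μ : Measure (CharSpace B)} (hμ : IsRepresenting L K μ) : IsProbabilityMeasure μ := by
  have h := hμ.integral_eq 1
  simp only [map_one, hL, integral_const, smul_eq_mul, mul_one, Measure.real] at h
  refine ⟨?_⟩
  rw [← ENNReal.toReal_eq_one_iff]
  exact h.symm

theorem IsRepresenting.map_res [m : MeasurableSpace (CharSpace A)] {L : A →ₗ[ℝ] ℝ}
    {K : Set (CharSpace A)} {μ : Measure (CharSpace A)} (hμ : IsRepresenting L K μ)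
    {S : Subalgebra ℝ A} (hres : Measurable (res S)) {K' : Set (CharSpace S)}
    (hK' : IsClosed K') (h : μ (res S ⁻¹' K')ᶜ = 0) :
    IsRepresenting (restrictFunctional L S) K' (μ.map (res S)) where
  supported := by
    rw [Measure.map_apply hres hK'.measurableSet.compl]
    exact h
  integrable a := by
    rw [integrable_map_measure (continuous_eval a).measurable.aestronglyMeasurable hres.aemeasurable]
    exact hμ.integrable a
  integral_eq a := by
    rw [integral_map hres.aemeasurable (continuous_eval a).measurable.aestronglyMeasurable]
    exact hμ.integral_eq a

/-- A measure represents `L` if all its projections to finitely generated subalgebras represent the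
restrictions of `L`. -/
theorem isRepresenting_of_map_res [m : MeasurableSpace (CharSpace A)] {L : A →ₗ[ℝ] ℝ}
    {μ : Measure (CharSpace A)} (hres : ∀ S : FGSub A, Measurable (res S.1))
    {K : ∀ S : FGSub A, Set (CharSpace S.1)}
    (h : ∀ S : FGSub A, IsRepresenting (restrictFunctional L S.1) (K S) (μ.map (res S.1))) :
    IsRepresenting L Set.univ μ where
  supported := by simp
  integrable a := by
    have := (h (adjoinFinset {a})).integrable ⟨a, mem_adjoinFinset_singleton a⟩
    rwa [integrable_map_measure (continuous_eval _).measurable.aestronglyMeasurable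
      (hres _).aemeasurable] at this
  integral_eq a := by
    have := (h (adjoinFinset {a})).integral_eq ⟨a, mem_adjoinFinset_singleton a⟩
    rwa [integral_map (hres _).aemeasurable (continuous_eval _).measurable.aestronglyMeasurable]
      at this

end Representing

/-! ### Part (ii): Radon representing measures -/

section Prokhorov

variable {L : A →ₗ[ℝ] ℝ}

theorem coe_nnnorm_sq (x : ℝ) : ((‖x‖₊ ^ 2 : ℝ≥0) : ℝ≥0∞) = ENNReal.ofReal (x ^ 2) := by
  rw [ENNReal.ofReal_eq_coe_nnreal (sq_nonneg x)]
  congr 1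
  ext
  simp

/-- The nonnegative square of the value of a character at `a`, set to zero if `a` is not in the
domain. -/
noncomputable def sqEval (a : A) (S : Subalgebra ℝ A) (α : CharSpace S) : ℝ≥0 :=
  open Classical in if h : a ∈ S then ‖α ⟨a, h⟩‖₊ ^ 2 else 0

theorem lintegral_sqEval {S : Subalgebra ℝ A} {a : A} (ha : a ∈ S) {K : Set (CharSpace S)}
    {μ : Measure (CharSpace S)} (hμ : IsRepresenting (restrictFunctional L S) K μ) :
    Measurable (sqEval a S) ∧ ∫⁻ α, sqEval a S α ∂μ ≤ ENNReal.ofReal (L (a * a)) := by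
  have hsq : sqEval a S = fun α => ‖α ⟨a, ha⟩‖₊ ^ 2 := by
    ext α
    simp [sqEval, ha]
  have hsq' : ∀ α, (sqEval a S α : ℝ≥0∞) = ENNReal.ofReal (α (⟨a, ha⟩ * ⟨a, ha⟩)) := by
    intro α
    rw [hsq, coe_nnnorm_sq, map_mul, sq]
  refine ⟨hsq ▸ ((continuous_eval _).measurable.nnnorm.pow_const 2), le_of_eq ?_⟩
  simp_rw [hsq']
  rw [← ofReal_integral_eq_lintegral_ofReal (hμ.integrable _), ← hμ.integral_eq]
  · rfl
  · exact Eventually.of_forall fun α => by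
      simp only [map_mul]
      exact mul_self_nonneg _

/-- If second moments are dominated by those of `L`, then first moments are equal to those
of `L`. -/
theorem integral_eq_of_lintegral_sq_le (hL : L 1 = 1) {ν : Measure (CharSpace A)}
    [IsProbabilityMeasure ν] (hpos : ∀ a : A, 0 ≤ L (a * a))
    (h : ∀ a : A, ∫⁻ α, ((‖α a‖₊ ^ 2 : ℝ≥0) : ℝ≥0∞) ∂ν ≤ ENNReal.ofReal (L (a * a))) (a : A) :
    Integrable (fun α : CharSpace A => α a) ν ∧ L a = ∫ α : CharSpace A, α a ∂ν := by
  have hmeas : ∀ a : A, AEStronglyMeasurable (fun α : CharSpace A => α a) ν := fun a =>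
    (continuous_eval a).measurable.aestronglyMeasurable
  have hsqint : ∀ a : A, Integrable (fun α : CharSpace A => α a ^ 2) ν := by
    intro a
    refine ⟨(hmeas a).pow 2, ?_⟩
    rw [hasFiniteIntegral_iff_ofReal (Eventually.of_forall fun α => sq_nonneg _)]
    simp_rw [← coe_nnnorm_sq]
    exact (h a).trans_lt ENNReal.ofReal_lt_top
  have hint : ∀ a : A, Integrable (fun α : CharSpace A => α a) ν := fun a =>
    ((memLp_two_iff_integrable_sq (hmeas a)).2 (hsqint a)).integrable (by norm_num)
  have hsqle : ∀ a : A, ∫ α : CharSpace A, α a ^ 2 ∂ν ≤ L (a * a) := by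
    intro a
    rw [integral_eq_lintegral_of_nonneg_ae (Eventually.of_forall fun α => sq_nonneg _)
      ((hmeas a).pow 2)]
    simp_rw [← coe_nnnorm_sq]
    exact ENNReal.toReal_le_of_le_ofReal (hpos a) (h a)
  refine ⟨hint a, ?_⟩
  -- This is the second-moment inequality for a + c·1, in which the c² terms cancel. A linear
  -- function of c bounded above on ℝ has slope zero.
  have hshift : ∀ c : ℝ, 2 * c * (∫ α : CharSpace A, α a ∂ν - L a)
      ≤ L (a * a) - ∫ α : CharSpace A, α a ^ 2 ∂ν := by
    intro c
    have h1 := hsqle (a + c • 1)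
    have h2 : L ((a + c • 1) * (a + c • 1)) = L (a * a) + 2 * c * L a + c ^ 2 := by
      have : (a + c • 1) * (a + c • 1) = a * a + (2 * c) • a + (c ^ 2) • (1 : A) := by
        simp only [Algebra.smul_def, mul_one, map_mul, map_pow, map_ofNat]
        ring
      rw [this, map_add, map_add, map_smul, map_smul, hL]
      simp
    have h3 : ∫ α : CharSpace A, α (a + c • 1) ^ 2 ∂ν
        = ∫ α : CharSpace A, α a ^ 2 ∂ν + 2 * c * ∫ α : CharSpace A, α a ∂ν + c ^ 2 := by
      have : ∀ α : CharSpace A, α (a + c • 1) ^ 2 = α a ^ 2 + 2 * c * α a + c ^ 2 := by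
        intro α
        rw [map_add, map_smul, map_one, smul_eq_mul]
        ring
      simp_rw [this]
      have hlin := (hint a).const_mul (2 * c)
      have hsum : Integrable (fun α : CharSpace A => α a ^ 2 + 2 * c * α a) ν :=
        (hsqint a).add hlin
      rw [integral_add hsum (integrable_const _), integral_add (hsqint a) hlin,
        integral_const_mul]
      simp
    rw [h2, h3] at h1
    linarith
  by_contra hne
  have hd : ∫ α : CharSpace A, α a ∂ν - L a ≠ 0 := sub_ne_zero.2 (Ne.symm hne)
  -- This c makes the left side exceed the bound by exactly 1.
  have h1 := hshift ((L (a * a) - ∫ α : CharSpace A, α a ^ 2 ∂ν + 1)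
    / (2 * (∫ α : CharSpace A, α a ∂ν - L a)))
  have h2 : 2 * ((L (a * a) - ∫ α : CharSpace A, α a ^ 2 ∂ν + 1)
      / (2 * (∫ α : CharSpace A, α a ∂ν - L a))) * (∫ α : CharSpace A, α a ∂ν - L a)
      = L (a * a) - ∫ α : CharSpace A, α a ^ 2 ∂ν + 1 := by
    field_simp
  linarith

/-- The index set may be uncountable, but a compact subset of the complement is covered by finitely
many of the open null sets, and inner regularity does the rest. -/
theorem measure_compl_iInter_eq_zero {X ι : Type*} [TopologicalSpace X] [MeasurableSpace X]
    [OpensMeasurableSpace X] {ν : Measure X} (hν : ν.InnerRegular) {F : ι → Set X}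
    (hF : ∀ i, IsClosed (F i)) (h : ∀ i, ν (F i)ᶜ = 0) : ν (⋂ i, F i)ᶜ = 0 := by
  have hopen : IsOpen (⋂ i, F i)ᶜ := (isClosed_iInter hF).isOpen_compl
  rw [hopen.measurableSet.measure_eq_iSup_isCompact, ← nonpos_iff_eq_zero]
  refine iSup₂_le fun C hCsub => iSup_le fun hC => ?_
  obtain ⟨t, ht⟩ := hC.elim_finite_subcover (fun i => (F i)ᶜ) (fun i => (hF i).isOpen_compl)
    (by rwa [← Set.compl_iInter])
  refine (measure_mono ht).trans (le_of_eq ?_)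
  exact (measure_biUnion_null_iff t.countable_toSet).2 fun i _ => h i

theorem exists_radon_representing (hL : L 1 = 1) {K : ∀ S : FGSub A, Set (CharSpace S.1)}
    (hKclosed : ∀ S, IsClosed (K S))
    (hKcompat : ∀ (S T : FGSub A) (h : S.1 ≤ T.1), resLE h '' K T ⊆ K S)
    {μ : ∀ S : FGSub A, Measure (CharSpace S.1)}
    (hμ : ∀ S, IsRepresenting (restrictFunctional L S.1) (K S) (μ S)) (hP : Prokhorov μ) :
    ∃ ν : Measure (CharSpace A), IsRadon ν ∧
      IsRepresenting L (⋂ S : FGSub A, res S.1 ⁻¹' K S) ν := by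
  have hprob : ∀ S, IsProbabilityMeasure (μ S) := fun S =>
    (hμ S).isProbabilityMeasure (L := restrictFunctional L S.1) hL
  have hU : ((Ultrafilter.of atTop : Ultrafilter (FGSub A)) : Filter (FGSub A)) ≤ atTop :=
    Ultrafilter.of_le _
  obtain ⟨ν, hν, hreg, hlim⟩ := exists_innerRegular_limit (X := CharSpace A)
    (p := fun S : FGSub A => res S.1) (fun S => continuous_res S.1)
    (fun x y hxy => by
      by_contra! hall
      refine hxy (AlgHom.ext fun b => ?_)
      exact DFunLike.congr_fun (hall (adjoinFinset {b})) ⟨b, mem_adjoinFinset_singleton b⟩)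
    (fun S T hST x y h => congrArg (resLE (show S.1 ≤ T.1 from hST)) h) μ hP _ hU
  have hmem : ∀ a : A, ∀ᶠ S : FGSub A in atTop, a ∈ S.1 := fun a => by
    filter_upwards [eventually_ge_atTop (adjoinFinset {a})] with S hS
    exact (show (adjoinFinset {a}).1 ≤ S.1 from hS) (mem_adjoinFinset_singleton a)
  have hmom := integral_eq_of_lintegral_sq_le hL (ν := ν) (fun a => by
      have h := (hμ (adjoinFinset {a})).integral_eq
        (⟨a, mem_adjoinFinset_singleton a⟩ * ⟨a, mem_adjoinFinset_singleton a⟩)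
      refine (integral_nonneg fun α => ?_).trans h.ge
      simp only [map_mul]
      exact mul_self_nonneg _) fun a => by
    have hcont : Continuous fun α : CharSpace A => ‖α a‖₊ ^ 2 :=
      (continuous_eval a).nnnorm.pow 2
    refine lintegral_le_of_superlevel (U := (Ultrafilter.of atTop : Ultrafilter (FGSub A)))
      (μ := μ) (g := fun S => sqEval a S.1) hcont.measurable
      (hU ((hmem a).mono fun S hS => lintegral_sqEval hS (hμ S))) fun t ε hε => ?_
    -- A superlevel set of â² is open and projects into the same superlevel set at every stage
    -- containing a.
    refine hlim _ (isOpen_lt continuous_const hcont) _ (hU ((hmem a).mono fun S hS => ?_)) ε hε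
    rintro _ ⟨α, hα, rfl⟩
    simpa [sqEval, hS, res_apply] using hα
  refine ⟨ν, ⟨inferInstance, hreg⟩, ⟨measure_compl_iInter_eq_zero hreg
    (fun S => (hKclosed S).preimage (continuous_res S.1)) fun S => ?_,
    fun a => (hmom a).1, fun a => (hmom a).2⟩⟩
  rw [← nonpos_iff_eq_zero]
  refine ENNReal.le_of_forall_pos_le_add fun ε hε _ => ?_
  -- For T ⊇ S a character violating K S also violates K T, by compatibility, so the open complement
  -- projects into null sets.
  have h1 := hlim _ ((hKclosed S).preimage (continuous_res S.1)).isOpen_compl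
    (fun T => (K T)ᶜ) (hU ((eventually_ge_atTop S).mono fun T hST => by
      rintro _ ⟨α, hα, rfl⟩ hαK
      exact hα (hKcompat S T hST ⟨_, hαK, rfl⟩))) ε (ENNReal.coe_ne_zero.2 hε.ne')
  obtain ⟨T, hT⟩ := h1.exists
  rwa [(hμ T).supported] at hT

/-- The projections of ν work: one compact set carrying ν up to ε serves every S, being contained in
the preimage of its image. -/
theorem exists_prokhorov_of_radon (hL : L 1 = 1) {K : ∀ S : FGSub A, Set (CharSpace S.1)}
    (hKclosed : ∀ S, IsClosed (K S)) {ν : Measure (CharSpace A)} (hν : IsRadon ν)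
    (hrep : IsRepresenting L (⋂ S : FGSub A, res S.1 ⁻¹' K S) ν) :
    ∃ μ : ∀ S : FGSub A, Measure (CharSpace S.1),
      (∀ S, IsRadon (μ S) ∧ IsRepresenting (restrictFunctional L S.1) (K S) (μ S)) ∧
      Prokhorov μ := by
  have := hrep.isProbabilityMeasure hL
  refine ⟨fun S => ν.map (res S.1), fun S => ⟨S.isRadon _, hrep.map_res (measurable_res S.1)
    (hKclosed S) (measure_mono_null ?_ hrep.supported)⟩, fun ε hε => ?_⟩
  · exact Set.compl_subset_compl.2 (Set.iInter_subset _ S)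
  · obtain ⟨C, hC, h⟩ := hν.exists_isCompact_ge (ENNReal.ofReal_pos.2 hε).ne'
    refine ⟨C, hC, fun S => ?_⟩
    rw [Measure.map_apply (measurable_res S.1) (hC.image (continuous_res S.1)).measurableSet,
      ENNReal.ofReal_sub _ hε.le, ENNReal.ofReal_one]
    exact h.trans (measure_mono (Set.subset_preimage_image _ _))

end Prokhorov

/-! ### Part (i): measures on the cylinder σ-algebra -/

section Cylinder

/-- Countably many countably generated subalgebras lie in a common one. -/
theorem CGSub.exists_upper_bound (T : ℕ → CGSub A) : ∃ V : CGSub A, ∀ n, (T n).1 ≤ V.1 := by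
  choose G hG hGT using fun n => (T n).2
  refine ⟨⟨Algebra.adjoin ℝ (⋃ n, G n), _, Set.countable_iUnion hG, rfl⟩, fun n => ?_⟩
  rw [← hGT n]
  exact Algebra.adjoin_mono (Set.subset_iUnion G n)

/-- Countably many cylinder sets have a common base. -/
theorem exists_common_base {T : ℕ → CGSub A} {M : ∀ n, Set (CharSpace (T n).1)}
    (hM : ∀ n, MeasurableSet (M n)) : ∃ (V : CGSub A) (hV : ∀ n, (T n).1 ≤ V.1),
      ∀ n, MeasurableSet (resLE (hV n) ⁻¹' M n) := by
  obtain ⟨V, hV⟩ := CGSub.exists_upper_bound T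
  exact ⟨V, hV, fun n => measurable_resLE (hV n) (hM n)⟩

/-- Every set in the cylinder `σ`-algebra is the preimage of a Borel set under the restriction to
some countably generated subalgebra. -/
theorem exists_base_of_measurableSet_cylinderSigma {B : Set (CharSpace A)}
    (hB : MeasurableSet[cylinderSigma A] B) :
    ∃ (T : CGSub A) (M : Set (CharSpace T.1)), MeasurableSet M ∧ res T.1 ⁻¹' M = B := by
  let m : MeasurableSpace (CharSpace A) :=
    { MeasurableSet' := fun B => ∃ (T : CGSub A) (M : Set (CharSpace T.1)),
        MeasurableSet M ∧ res T.1 ⁻¹' M = B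
      measurableSet_empty :=
        ⟨⟨_, (Classical.arbitrary (FGSub A)).countably_generated⟩, ∅, MeasurableSet.empty, rfl⟩
      measurableSet_compl := by
        rintro _ ⟨T, M, hM, rfl⟩
        exact ⟨T, Mᶜ, hM.compl, rfl⟩
      measurableSet_iUnion := by
        intro f hf
        choose T M hM hMf using hf
        obtain ⟨V, hV, hVM⟩ := exists_common_base hM
        refine ⟨V, ⋃ n, resLE (hV n) ⁻¹' M n, MeasurableSet.iUnion hVM, ?_⟩
        rw [Set.preimage_iUnion]
        exact Set.iUnion_congr fun n => hMf n }
  have hle : cylinderSigma A ≤ m := by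
    refine iSup_le fun S => ?_
    rintro _ ⟨M, hM, rfl⟩
    exact ⟨⟨S.1, S.countably_generated⟩, M, hM, rfl⟩
  exact hle B hB

variable {ν : ∀ T : CGSub A, Measure (CharSpace T.1)}

/-- Pulled back to a common V, the first set minus the second misses the range of `res V.1`, hence
is null by thickness. -/
theorem IsThick.measure_mono (hthick : IsThick ν) (hex : IsExact ν) {T T' : CGSub A}
    {M : Set (CharSpace T.1)} {M' : Set (CharSpace T'.1)} (hM : MeasurableSet M)
    (hM' : MeasurableSet M') (h : res T.1 ⁻¹' M ⊆ res T'.1 ⁻¹' M') : ν T M ≤ ν T' M' := by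
  obtain ⟨V, hV⟩ := CGSub.exists_upper_bound fun n : ℕ => if n = 0 then T else T'
  have hT : T.1 ≤ V.1 := by simpa using hV 0
  have hT' : T'.1 ≤ V.1 := by simpa using hV 1
  rw [← hex T V hT, ← hex T' V hT', Measure.map_apply (measurable_resLE hT) hM,
    Measure.map_apply (measurable_resLE hT') hM']
  have hnull : ν V (resLE hT ⁻¹' M \ resLE hT' ⁻¹' M') = 0 := by
    refine hthick V _ ((measurable_resLE hT hM).diff (measurable_resLE hT' hM')) ?_
    rw [Set.disjoint_left]
    rintro _ ⟨α, rfl⟩ ⟨hα, hα'⟩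
    exact hα' (h hα)
  exact measure_mono_ae (ae_le_set.2 hnull)

theorem IsThick.measure_congr (hthick : IsThick ν) (hex : IsExact ν) {T T' : CGSub A}
    {M : Set (CharSpace T.1)} {M' : Set (CharSpace T'.1)} (hM : MeasurableSet M)
    (hM' : MeasurableSet M') (h : res T.1 ⁻¹' M = res T'.1 ⁻¹' M') : ν T M = ν T' M' :=
  le_antisymm (hthick.measure_mono hex hM hM' h.le) (hthick.measure_mono hex hM' hM h.ge)

/-- A thick exact family over the countably generated subalgebras is induced by a measure on the
cylinder `σ`-algebra. -/
theorem IsThick.exists_measure (hthick : IsThick ν) (hex : IsExact ν) :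
    ∃ μ : @Measure (CharSpace A) (cylinderSigma A), ∀ (T : CGSub A) (M : Set (CharSpace T.1)),
      MeasurableSet M → μ (res T.1 ⁻¹' M) = ν T M := by
  choose T M hM hMB using
    fun (B : Set (CharSpace A)) (hB : MeasurableSet[cylinderSigma A] B) =>
      exists_base_of_measurableSet_cylinderSigma hB
  let μ : @Measure (CharSpace A) (cylinderSigma A) :=
    @Measure.ofMeasurable _ (cylinderSigma A) (fun B hB => ν (T B hB) (M B hB))
      ((hthick.measure_congr hex (hM ∅ _)
        (MeasurableSet.empty (α := CharSpace (T ∅ (@MeasurableSet.empty _ (cylinderSigma A))).1))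
        (hMB ∅ _)).trans measure_empty)
      (by
        intro f hf hdisj
        obtain ⟨V, hV, hVM⟩ := exists_common_base fun n => hM (f n) (hf n)
        have hpre : ∀ n, res V.1 ⁻¹' (resLE (hV n) ⁻¹' M (f n) (hf n)) = f n := fun n =>
          hMB (f n) (hf n)
        rw [hthick.measure_congr hex (hM _ _) (MeasurableSet.iUnion hVM)
            ((hMB _ _).trans (by rw [Set.preimage_iUnion]; exact (Set.iUnion_congr hpre).symm)),
          measure_iUnion₀ ?_ fun n => (hVM n).nullMeasurableSet]
        · exact tsum_congr fun n =>
            hthick.measure_congr hex (hVM n) (hM _ _) ((hpre n).trans (hMB _ _).symm)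
        -- The bases in X(V) need not be disjoint, but their intersections miss the range of `res
        -- V.1`, so they are disjoint up to null sets.
        · intro i j hij
          refine hthick V _ ((hVM i).inter (hVM j)) ?_
          rw [Set.disjoint_left]
          rintro _ ⟨α, rfl⟩ ⟨hi, hj⟩
          have hfij : Disjoint (f i) (f j) := hdisj hij
          have hi' : α ∈ f i := by rw [← hpre i]; exact hi
          have hj' : α ∈ f j := by rw [← hpre j]; exact hj
          exact Set.disjoint_left.1 hfij hi' hj')
  refine ⟨μ, fun V N hN => ?_⟩
  have hB : MeasurableSet[cylinderSigma A] (res V.1 ⁻¹' N) := measurable_res_cylinderSigma V hN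
  rw [@Measure.ofMeasurable_apply _ (cylinderSigma A) _ _ _ _ hB]
  exact hthick.measure_congr hex (hM _ _) hN (hMB _ _)

variable {L : A →ₗ[ℝ] ℝ} {K : ∀ S : FGSub A, Set (CharSpace S.1)}

theorem exists_cylinder_representing (hKclosed : ∀ S, IsClosed (K S))
    {μ : ∀ S : FGSub A, Measure (CharSpace S.1)}
    (hμ : ∀ S, IsRepresenting (restrictFunctional L S.1) (K S) (μ S))
    (hind : IsInduced μ ν) (hthick : IsThick ν) :
    ∃ μ : @Measure (CharSpace A) (cylinderSigma A), IsRepresenting L Set.univ μ ∧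
      ∀ S : FGSub A, μ (res S.1 ⁻¹' K S)ᶜ = 0 := by
  obtain ⟨ρ, hρ⟩ := hthick.exists_measure hind.isExact
  have hρS : ∀ (S : FGSub A) (M : Set (CharSpace S.1)), MeasurableSet M →
      ρ (res S.1 ⁻¹' M) = μ S M := by
    intro S M hM
    have h := (hind ⟨S.1, S.countably_generated⟩).2.2 S le_rfl
    rw [← h, Measure.map_apply (measurable_resLE _) hM]
    exact hρ ⟨S.1, S.countably_generated⟩ M hM
  have hmap : ∀ S : FGSub A, @Measure.map _ _ (cylinderSigma A) _ (res S.1) ρ = μ S := by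
    intro S
    refine Measure.ext fun M hM => ?_
    rw [@Measure.map_apply _ _ (cylinderSigma A) _ _ _ (measurable_res_cylinderSigma_of_fg S) _ hM]
    exact hρS S M hM
  refine ⟨ρ, @isRepresenting_of_map_res _ _ _ (cylinderSigma A) L ρ
    measurable_res_cylinderSigma_of_fg K fun S => ?_, fun S => ?_⟩
  · rw [hmap S]
    exact hμ S
  · exact (hρS S _ (hKclosed S).measurableSet.compl).trans (hμ S).supported

/-- Both families are the pushforwards of ρ; the Radon property is automatic on these Polish spaces,
and exactness is functoriality of the pushforward. -/
theorem exists_thick_of_cylinder_representing (hL : L 1 = 1) (hKclosed : ∀ S, IsClosed (K S))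
    {ρ : @Measure (CharSpace A) (cylinderSigma A)} (hρ : IsRepresenting L Set.univ ρ)
    (hρK : ∀ S : FGSub A, ρ (res S.1 ⁻¹' K S)ᶜ = 0) :
    ∃ μ : ∀ S : FGSub A, Measure (CharSpace S.1),
      (∀ S, IsRadon (μ S) ∧ IsRepresenting (restrictFunctional L S.1) (K S) (μ S)) ∧
      IsExact μ ∧
      ∃ ν : ∀ T : CGSub A, Measure (CharSpace T.1), IsInduced μ ν ∧ IsThick ν := by
  have hprob := hρ.isProbabilityMeasure hL
  have hT := measurable_res_cylinderSigma (A := A)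
  have hS := measurable_res_cylinderSigma_of_fg (A := A)
  have hmapT : ∀ T : CGSub A, IsProbabilityMeasure
      (@Measure.map _ _ (cylinderSigma A) _ (res T.1) ρ) := fun T =>
    @Measure.isProbabilityMeasure_map _ _ (cylinderSigma A) _ ρ _ _ (hT T).aemeasurable
  have hmapS : ∀ S : FGSub A, IsProbabilityMeasure
      (@Measure.map _ _ (cylinderSigma A) _ (res S.1) ρ) := fun S =>
    @Measure.isProbabilityMeasure_map _ _ (cylinderSigma A) _ ρ _ _ (hS S).aemeasurable
  refine ⟨fun S => @Measure.map _ _ (cylinderSigma A) _ (res S.1) ρ,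
    fun S => ⟨S.isRadon _, @IsRepresenting.map_res _ _ _ (cylinderSigma A) _ _ _ hρ _ (hS S) _
      (hKclosed S) (hρK S)⟩, fun S T h => ?_,
    fun T => @Measure.map _ _ (cylinderSigma A) _ (res T.1) ρ,
    fun T => ⟨T.isRadon _, hmapT T, fun S h => ?_⟩, fun T M hM hdisj => ?_⟩
  · exact @Measure.map_map _ _ _ (cylinderSigma A) _ _ ρ _ _ (measurable_resLE h) (hS T)
  · exact @Measure.map_map _ _ _ (cylinderSigma A) _ _ ρ _ _ (measurable_resLE h) (hT T)
  · rw [@Measure.map_apply _ _ (cylinderSigma A) _ _ _ (hT T) _ hM]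
    convert! @measure_empty _ _ _ _ ρ
    exact Set.preimage_eq_empty hdisj.symm

end Cylinder

end CharMoment

/-! ### The main theorem -/

theorem mainTheorem1 {A : Type*} [CommRing A] [Algebra ℝ A]
    (L : A →ₗ[ℝ] ℝ) (hL : L 1 = 1)
    (K : ∀ S : CharMoment.FGSub A, Set (CharMoment.CharSpace S.1))
    (hKclosed : ∀ S : CharMoment.FGSub A, IsClosed (K S))
    (hKcompat : ∀ (S T : CharMoment.FGSub A) (h : S.1 ≤ T.1),
      CharMoment.resLE h '' K T ⊆ K S) :
    -- the system over the countably generated subalgebras used in (i) is well defined and exact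
    (∀ μ : ∀ S : CharMoment.FGSub A, Measure (CharMoment.CharSpace S.1),
      (∀ S, CharMoment.IsRadon (μ S) ∧ IsProbabilityMeasure (μ S)) → CharMoment.IsExact μ →
        (∃! ν : ∀ T : CharMoment.CGSub A, Measure (CharMoment.CharSpace T.1),
          CharMoment.IsInduced μ ν) ∧
        ∀ ν : ∀ T : CharMoment.CGSub A, Measure (CharMoment.CharSpace T.1),
          CharMoment.IsInduced μ ν → CharMoment.IsExact ν) ∧
    -- (i)
    ((∃ μ : @Measure (CharMoment.CharSpace A) (CharMoment.cylinderSigma A),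
        CharMoment.IsRepresenting L Set.univ μ ∧
        ∀ S : CharMoment.FGSub A, μ (CharMoment.res S.1 ⁻¹' K S)ᶜ = 0) ↔
      ∃ μ : ∀ S : CharMoment.FGSub A, Measure (CharMoment.CharSpace S.1),
        (∀ S, CharMoment.IsRadon (μ S) ∧
          CharMoment.IsRepresenting (CharMoment.restrictFunctional L S.1) (K S) (μ S)) ∧
        CharMoment.IsExact μ ∧
        ∃ ν : ∀ T : CharMoment.CGSub A, Measure (CharMoment.CharSpace T.1),
          CharMoment.IsInduced μ ν ∧ CharMoment.IsThick ν) ∧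
    -- (ii)
    ((∃ ν : Measure (CharMoment.CharSpace A),
        CharMoment.IsRadon ν ∧
        CharMoment.IsRepresenting L (⋂ S : CharMoment.FGSub A, CharMoment.res S.1 ⁻¹' K S) ν) ↔
      ∃ μ : ∀ S : CharMoment.FGSub A, Measure (CharMoment.CharSpace S.1),
        (∀ S, CharMoment.IsRadon (μ S) ∧
          CharMoment.IsRepresenting (CharMoment.restrictFunctional L S.1) (K S) (μ S)) ∧
        CharMoment.Prokhorov μ) := by
  have hprob : ∀ μ : ∀ S : CharMoment.FGSub A, Measure (CharMoment.CharSpace S.1),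
      (∀ S, CharMoment.IsRadon (μ S) ∧
        CharMoment.IsRepresenting (CharMoment.restrictFunctional L S.1) (K S) (μ S)) →
      ∀ S, IsProbabilityMeasure (μ S) := fun μ hμ S =>
    (hμ S).2.isProbabilityMeasure (L := CharMoment.restrictFunctional L S.1) hL
  refine ⟨fun μ hμ hex => ⟨?_, fun ν hν => hν.isExact⟩, ⟨?_, ?_⟩, ⟨?_, ?_⟩⟩
  · have := fun S => (hμ S).2
    obtain ⟨ν, hν⟩ := CharMoment.exists_isInduced (fun S => (hμ S).1) hex
    exact ⟨ν, hν, fun ν' hν' => hν'.unique hν⟩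
  · rintro ⟨ρ, hρ, hρK⟩
    exact CharMoment.exists_thick_of_cylinder_representing hL hKclosed hρ hρK
  · rintro ⟨μ, hμ, -, ν, hind, hthick⟩
    exact CharMoment.exists_cylinder_representing hKclosed (fun S => (hμ S).2) hind hthick
  · rintro ⟨ν, hν, hrep⟩
    exact CharMoment.exists_prokhorov_of_radon hL hKclosed hν hrep
  · rintro ⟨μ, hμ, hP⟩
    exact CharMoment.exists_radon_representing hL hKclosed hKcompat (fun S => (hμ S).2) hP
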